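/- Let $\mathbb E_1,\mathbb E_2$ be finite-dimensional real inner product spaces, let $X\subset\mathbb E_1$ be a nonempty convex set and let $K,L\subset\mathbb E_2$ be nonempty closed convex cones. Let $\mathbb E_2^\bullet=\mathbb E_2\cup\{+\infty_\bullet\}$ be $\mathbb E_2$ with an added largest element. For $F:\mathbb E_1\to\mathbb E_2^\bullet$ put $\mathrm{dom}\,F=\{x: F(x)\in\mathbb E_2\}$ and $K\text{-epi}\,F=\{(x,w)\in\mathbb E_1\times\mathbb E_2: x\in\mathrm{dom}\,F,\ w-F(x)\in K\}$; $F$ is called $K$-convex if $K\text{-epi}\,F$ is convex. For $g:\mathbb E_2\to\mathbb R\cup\{+\infty\}$ set $(g\circ F)(x)=g(F(x))$ if $x\in\mathrm{dom}\,F$ and $+\infty$ otherwise, and write $g(F(x))$ for $(g\circ F)(x)$ for every $x\in\mathbb E_1$; for $v\in\mathbb E_2$ set $\langle v,F\rangle=\langle v,\cdot\rangle\circ F$. Write $h^*(y)=\sup_x\{\langle y,x\rangle-h(x)\}$ for the Fenchel conjugate, $\sigma_X(s)=\sup_{x\in X}\langle s,x\rangle$ for the support function, $K^\circ=\{v:\langle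 v,x\rangle\le 0\ \text{for all } x\in K\}$ for the polar cone, $\mathrm{dom}\,h=\{x:h(x)<+\infty\}$ for the domain of an extended-real-valued $h$, and $\mathrm{ri}$ for the relative interior. Let $F:\mathbb E_1\to\mathbb E_2^\bullet$ be $K$-convex, let $G:\mathbb E_1\to\mathbb E_2^\bullet$ be $L$-convex, and let $f:\mathbb E_1\to\mathbb R\cup\{+\infty\}$ and $g:\mathbb E_2\to\mathbb R\cup\{+\infty\}$ be proper convex functions (not necessarily lower semicontinuous) such that $$g(F(x))\le g(w)\qquad\text{for all }(x,w)\in K\text{-epi}\,F .$$ Assume that there exists $\bar x\in\mathrm{ri}\,X\cap\mathrm{ri}(\mathrm{dom}\,f)\cap\mathrm{ri}(\mathrm{dom}\,F)\cap\mathrm{ri}(\mathrm{dom}\,G)$ with $F(\bar x)\in\mathrm{ri}(\mathrm{dom}\,g-K)$ and $G(\bar x)\in\mathrm{ri}(-L)$. Then the following are equivalent: a) for every $x\in X$ with $G(x)\in -L$ one has $f(x)+g(F(x))\ge 0$; b) there exist $\bar y,\bar z,\bar s\in\mathbb E_1$, $\bar u\in -K^\circ$ and $\bar v\in -L^\circ$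 such that $$g^*(\bar u)+\langle\bar u,F\rangle^*(\bar y)+\langle\bar v,G\rangle^*(\bar z)+\sigma_X(\bar s)+f^*(-\bar y-\bar z-\bar s)\le 0 .$$ -/

import Mathlib

open scoped Pointwise

namespace ConvexComposite

noncomputable section

variable {E E₁ E₂ : Type*}
  [NormedAddCommGroup E] [InnerProductSpace ℝ E]
  [NormedAddCommGroup E₁] [InnerProductSpace ℝ E₁]
  [NormedAddCommGroup E₂] [InnerProductSpace ℝ E₂]

/-- The effective domain of an extended-real-valued function. -/
def effDom (f : E → EReal) : Set E := {x | f x < ⊤}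

/-- The epigraph of an extended-real-valued function, a subset of `E × ℝ`. -/
def epigraph (f : E → EReal) : Set (E × ℝ) := {p | f p.1 ≤ (p.2 : EReal)}

/-- The class `Γ(E)` of proper convex functions `E → ℝ ∪ {+∞}` (not necessarily lower
semicontinuous). -/
structure IsGamma (f : E → EReal) : Prop where
  ne_bot : ∀ x, f x ≠ ⊥
  nonempty_dom : (effDom f).Nonempty
  convex_epigraph : Convex ℝ (epigraph f)

/-- The Fenchel conjugate `f*(y) = sup_x {⟨y, x⟩ - f x}`. -/
def conj (f : E → EReal) (y : E) : EReal :=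
  ⨆ x : E, (((inner ℝ y x : ℝ) : EReal) - f x)

/-- The support function `σ_X(s) = sup_{x ∈ X} ⟨s, x⟩`. -/
def supportFun (X : Set E) (s : E) : EReal :=
  ⨆ x ∈ X, ((inner ℝ s x : ℝ) : EReal)

/-- The polar cone `K° = {v | ⟨v, x⟩ ≤ 0 for all x ∈ K}`. -/
def polarCone (K : Set E) : Set E := {v | ∀ x ∈ K, inner ℝ v x ≤ 0}

/-- The domain of a function with values in `E₂ ∪ {+∞•}`, modelled as `WithTop E₂`. -/
def vecDom (F : E₁ → WithTop E₂) : Set E₁ := {x | F x ≠ ⊤}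

/-- The `K`-epigraph `{(x, v) | F x ≤_K v}`, where `F x ≤_K v` means that `F x` is an element of
`E₂` with `v - F x ∈ K`. -/
def coneEpigraph (K : Set E₂) (F : E₁ → WithTop E₂) : Set (E₁ × E₂) :=
  {p | ∃ w : E₂, F p.1 = (w : WithTop E₂) ∧ p.2 - w ∈ K}

/-- `F` is `K`-convex: its `K`-epigraph is convex. -/
def ConeConvex (K : Set E₂) (F : E₁ → WithTop E₂) : Prop :=
  Convex ℝ (coneEpigraph K F)

/-- The composition `g ∘ F`, equal to `g (F x)` on `dom F` and to `+∞` outside `dom F`. -/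
def compTop (g : E₂ → EReal) (F : E₁ → WithTop E₂) (x : E₁) : EReal :=
  WithTop.recTopCoe (C := fun _ => EReal) ⊤ g (F x)

/-- The scalarization `⟨v, F⟩ = ⟨v, ·⟩ ∘ F`. -/
def scalarization (v : E₂) (F : E₁ → WithTop E₂) : E₁ → EReal :=
  compTop (fun w => ((inner ℝ v w : ℝ) : EReal)) F

/-- The monotonicity condition `g (F x) ≤ g y` for all `(x, y)` in the `K`-epigraph of `F`. -/
def MonotoneAlong (K : Set E₂) (F : E₁ → WithTop E₂) (g : E₂ → EReal) : Prop :=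
  ∀ p ∈ coneEpigraph K F, compTop g F p.1 ≤ g p.2

/-- The qualification condition: some `x` lies in the relative interiors of `X`, `dom f`, `dom F`
and `dom G`, with `F x ∈ ri (dom g - K)` and `G x ∈ ri (-L)`. -/
def FarkasCQ (X : Set E₁) (K L : Set E₂) (f : E₁ → EReal) (g : E₂ → EReal)
    (F G : E₁ → WithTop E₂) : Prop :=
  ∃ x ∈ intrinsicInterior ℝ X ∩ intrinsicInterior ℝ (effDom f) ∩
      intrinsicInterior ℝ (vecDom F) ∩ intrinsicInterior ℝ (vecDom G),
    (∃ a ∈ intrinsicInterior ℝ (effDom g - K), F x = (a : WithTop E₂)) ∧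
    (∃ b ∈ intrinsicInterior ℝ (-L), G x = (b : WithTop E₂))

end

end ConvexComposite

/-! b) gives a) by adding the Fenchel-Young inequalities at a feasible `x`; `v ∈ -L°` makes `⟨v, G
x⟩ ≤ 0`. For the converse, give `f`, `X`, `F` and `G` separate copies of `x`, and `g` its own
argument. The disagreements between copies form a perturbation, and the pairs (perturbation, value
of `f + g`) form a convex set. By a) and monotonicity of `g` along `F`, values at perturbation zero
are nonnegative. The qualification condition puts zero in the relative core of the perturbations
(`isRelCore_shiftedEpigraph`), so a linear functional minorizes the set (`exists_linear_minorant`).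
Its components are the multipliers. As the copies vary independently, the minorization splits into
five suprema, which are the conjugates in b). -/

namespace ConvexComposite

/-! ### Relative algebraic interior and linear minorants -/

section RelativeCore

variable {V W : Type*} [AddCommGroup V] [Module ℝ V] [AddCommGroup W] [Module ℝ W]

/-- `c` belongs to the relative algebraic interior of `C`: every segment of `C` that ends in `c`
can be prolonged beyond `c` inside `C`. -/
def IsRelCore (C : Set V) (c : V) : Prop :=
  c ∈ C ∧ ∀ y ∈ C, ∃ ε : ℝ, 0 < ε ∧ c - ε • (y - c) ∈ C

lemma prolongation_mem_of_le {C : Set V} (hC : Convex ℝ C) {c y : V} (hc : c ∈ C) {ε δ : ℝ}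
    (hε : 0 < ε) (h : c - ε • (y - c) ∈ C) (hδ : 0 ≤ δ) (hδε : δ ≤ ε) :
    c - δ • (y - c) ∈ C := by
  have h' : c + (-(ε • (y - c))) ∈ C := by rwa [← sub_eq_add_neg]
  have := hC.add_smul_mem hc h' (t := δ / ε) ⟨by positivity, (div_le_one hε).2 hδε⟩
  convert this using 1
  rw [smul_neg, smul_smul, div_mul_cancel₀ _ hε.ne', sub_eq_add_neg]

lemma IsRelCore.prod {C : Set V} {D : Set W} (hC : Convex ℝ C) (hD : Convex ℝ D) {c : V} {d : W}
    (hc : IsRelCore C c) (hd : IsRelCore D d) : IsRelCore (C ×ˢ D) (c, d) := by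
  refine ⟨⟨hc.1, hd.1⟩, ?_⟩
  rintro ⟨y, z⟩ ⟨hy, hz⟩
  obtain ⟨ε, hε, h⟩ := hc.2 y hy
  obtain ⟨δ, hδ, h'⟩ := hd.2 z hz
  have hm : 0 < min ε δ := lt_min hε hδ
  exact ⟨min ε δ, hm, prolongation_mem_of_le hC hc.1 hε h hm.le (min_le_left _ _),
    prolongation_mem_of_le hD hd.1 hδ h' hm.le (min_le_right _ _)⟩

lemma IsRelCore.image {C : Set V} {c : V} (hc : IsRelCore C c) (T : V →ₗ[ℝ] W) :
    IsRelCore (T '' C) (T c) := by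
  refine ⟨⟨c, hc.1, rfl⟩, ?_⟩
  rintro _ ⟨y, hy, rfl⟩
  obtain ⟨ε, hε, h⟩ := hc.2 y hy
  exact ⟨ε, hε, _, h, by simp⟩

lemma isRelCore_of_mem_intrinsicInterior {E : Type*} [NormedAddCommGroup E] [NormedSpace ℝ E]
    {C : Set E} {c : E} (h : c ∈ intrinsicInterior ℝ C) : IsRelCore C c := by
  refine ⟨intrinsicInterior_subset h, fun y hy => ?_⟩
  rw [mem_intrinsicInterior] at h
  obtain ⟨c', hc', rfl⟩ := h
  let y' : affineSpan ℝ C := ⟨y, subset_affineSpan ℝ C hy⟩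
  have hcont : Continuous fun t : ℝ =>
      (⟨AffineMap.lineMap (c' : E) (y' : E) t,
        AffineMap.lineMap_mem t c'.2 y'.2⟩ : affineSpan ℝ C) :=
    Continuous.subtype_mk AffineMap.lineMap_continuous _
  have hmem := hcont.continuousAt.preimage_mem_nhds (x := 0)
    (t := interior ((↑) ⁻¹' C : Set (affineSpan ℝ C)))
    (isOpen_interior.mem_nhds (by simpa using hc'))
  obtain ⟨ε, hε, hball⟩ := Metric.mem_nhds_iff.1 hmem
  have hin : -(ε / 2) ∈ Metric.ball (0 : ℝ) ε := by
    rw [mem_ball_zero_iff, norm_neg, Real.norm_of_nonneg (by positivity)]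
    linarith
  have := interior_subset (hball hin)
  refine ⟨ε / 2, by positivity, ?_⟩
  simp only [Set.mem_preimage, AffineMap.lineMap_apply_module'] at this
  convert this using 1
  simp only [y']
  module

/-- A convex set of pairs `(p, t)` whose projection has the origin in its relative algebraic
interior and which has no `(0, t)` with `t < 0` lies above the graph of a linear functional. -/
theorem exists_linear_minorant {S : Set (V × ℝ)} (hS : Convex ℝ S)
    (hcore : IsRelCore (Prod.fst '' S) 0) (h0 : ∀ t, ((0 : V), t) ∈ S → 0 ≤ t) :
    ∃ l : V →ₗ[ℝ] ℝ, ∀ p ∈ S, l p.1 ≤ p.2 := by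
  have hD : Convex ℝ (Prod.fst '' S) := hS.linear_image (LinearMap.fst ℝ V ℝ)
  have hcone : ∀ m, m ∈ ConvexCone.hull ℝ (Prod.fst '' S) ↔
      ∃ r : ℝ, 0 < r ∧ ∃ y ∈ Prod.fst '' S, r • y = m :=
    fun m => ConvexCone.mem_hull_of_convex hD
  let M : Submodule ℝ V :=
    { carrier := {m | m ∈ ConvexCone.hull ℝ (Prod.fst '' S)}
      zero_mem' := (hcone _).2 ⟨1, one_pos, 0, hcore.1, by simp⟩
      add_mem' := fun ha hb => (ConvexCone.hull ℝ (Prod.fst '' S)).add_mem ha hb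
      smul_mem' := by
        intro c x hx
        rcases lt_trichotomy c 0 with hc | rfl | hc
        · obtain ⟨r, hr, y, hy, rfl⟩ := (hcone _).1 hx
          obtain ⟨ε, hε, h⟩ := hcore.2 y hy
          -- Prolonging through the origin gives `-ε • y` in the projection; this makes the conic
          -- hull a subspace.
          refine (hcone _).2 ⟨-c * r / ε, ?_, _, h, ?_⟩
          · have : 0 < -c := by linarith
            positivity
          · rw [zero_sub, sub_zero, smul_neg, smul_smul, smul_smul, ← neg_smul]
            congr 1
            field_simp
        · simpa using (hcone _).2 ⟨1, one_pos, 0, hcore.1, by simp⟩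
        · exact (ConvexCone.hull ℝ (Prod.fst '' S)).smul_mem hc hx }
  obtain ⟨q₀, hq₀, -⟩ := hcore.1
  let s : PointedCone ℝ (M × ℝ) :=
    { carrier := {z | ∃ r : ℝ, 0 ≤ r ∧ ∃ q ∈ S, r • q = ((z.1 : V), z.2)}
      zero_mem' := ⟨0, le_rfl, q₀, hq₀, zero_smul _ _⟩
      add_mem' := by
        rintro z w ⟨a, ha, p, hp, hz⟩ ⟨b, hb, q, hq, hw⟩
        have hsum : a • p + b • q = (((z + w).1 : V), (z + w).2) := by
          rw [hz, hw]; simp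
        rcases eq_or_lt_of_le (add_nonneg ha hb) with h | h
        · have ha0 : a = 0 := by linarith
          have hb0 : b = 0 := by linarith
          exact ⟨0, le_rfl, q₀, hq₀, by
            rw [← hsum, ha0, hb0, zero_smul, zero_smul, zero_smul, add_zero]⟩
        · refine ⟨a + b, h.le, (a / (a + b)) • p + (b / (a + b)) • q,
            hS hp hq (by positivity) (by positivity) (by field_simp), ?_⟩
          rw [← hsum, smul_add, smul_smul, smul_smul, mul_div_cancel₀ _ h.ne',
            mul_div_cancel₀ _ h.ne']
      smul_mem' := by
        rintro c z ⟨a, ha, p, hp, hz⟩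
        refine ⟨c * a, mul_nonneg c.2 ha, p, hp, ?_⟩
        rw [mul_smul, hz]
        rfl }
  -- `(0, t) ↦ t` on the vertical line, nonnegative on the cone `s` over `S` by `h0`.
  let φ : (M × ℝ) →ₗ.[ℝ] ℝ :=
    { domain := Submodule.prod ⊥ ⊤
      toFun := (LinearMap.snd ℝ M ℝ).comp (Submodule.subtype _) }
  obtain ⟨k, hk, hpos⟩ := riesz_extension s φ
    (by
      rintro ⟨⟨m, t⟩, hm, _⟩ hz
      obtain ⟨r, hr, q, hq, hz⟩ := hz
      have hm0 : m = 0 := hm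
      subst hm0
      change 0 ≤ t
      have h1 : r • q.1 = 0 := congrArg Prod.fst hz
      have h2 : r * q.2 = t := congrArg Prod.snd hz
      rcases eq_or_lt_of_le hr with rfl | hr'
      · simp [← h2]
      · have hq1 : q.1 = 0 := (smul_eq_zero.1 h1).resolve_left hr'.ne'
        rw [← h2]
        exact mul_nonneg hr (h0 q.2 (by rw [← hq1]; exact hq)))
    (by
      rintro ⟨m, t⟩
      obtain ⟨r, hr, _, ⟨q, hq, rfl⟩, hm⟩ := (hcone m).1 m.2
      -- A vertical shift takes `(m, t)` to the point `r • q` of the cone.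
      refine ⟨⟨(0, r * q.2 - t), ?_⟩, r, hr.le, q, hq, ?_⟩
      · exact ⟨rfl, trivial⟩
      · ext
        · simpa using hm
        · simp)
  have hk' : ∀ t : ℝ, k (0, t) = t := fun t => hk ⟨(0, t), rfl, trivial⟩
  -- Since `k (m, t) = k (m, 0) + t`, positivity of `k` on `S` says that `-k (·, 0)` is a minorant.
  obtain ⟨l, hl⟩ := LinearMap.exists_extend (-(k.comp (LinearMap.inl ℝ M ℝ)))
  refine ⟨l, fun q hq => ?_⟩
  have hq1 : q.1 ∈ M := (hcone _).2 ⟨1, one_pos, _, ⟨q, hq, rfl⟩, one_smul _ _⟩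
  have hlq : l q.1 = -k (⟨q.1, hq1⟩, 0) := congrArg (fun T => T ⟨q.1, hq1⟩) hl
  have h := hpos (⟨q.1, hq1⟩, q.2) ⟨1, zero_le_one, q, hq, one_smul _ _⟩
  have hsplit : ((⟨q.1, hq1⟩, q.2) : M × ℝ) = (⟨q.1, hq1⟩, 0) + (0, q.2) := by simp
  rw [hsplit, map_add, hk'] at h
  linarith

end RelativeCore

/-! ### Cone epigraphs and their relative core -/

section ConeEpigraph

variable {E₁ E₂ : Type*}
  [NormedAddCommGroup E₁] [InnerProductSpace ℝ E₁]
  [NormedAddCommGroup E₂] [InnerProductSpace ℝ E₂]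

lemma mem_coneEpigraph_of_eq {T : Type*} {K : ProperCone ℝ E₂} {F : T → WithTop E₂} {x : T} {a : E₂}
    (h : F x = (a : WithTop E₂)) : (x, a) ∈ coneEpigraph (K : Set E₂) F :=
  ⟨a, h, by simp⟩

lemma add_mem_coneEpigraph {T : Type*} {K : ProperCone ℝ E₂} {F : T → WithTop E₂} {x : T} {w k : E₂}
    (h : (x, w) ∈ coneEpigraph (K : Set E₂) F) (hk : k ∈ K) :
    (x, w + k) ∈ coneEpigraph (K : Set E₂) F := by
  obtain ⟨a, ha, hw⟩ := h
  refine ⟨a, ha, ?_⟩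
  have : w + k - a = (w - a) + k := by abel
  rw [this]
  exact K.add_mem hw hk

lemma convex_properCone (K : ProperCone ℝ E₂) : Convex ℝ (K : Set E₂) :=
  fun _ hx _ hy _ _ ha hb _ => K.add_mem (K.smul_mem hx ha) (K.smul_mem hy hb)

/-- The pairs `(x, w - w')` with `(x, w)` in the `K`-epigraph of `F` and `w' ∈ A`. -/
def shiftedEpigraph (K : Set E₂) (F : E₁ → WithTop E₂) (A : Set E₂) : Set (E₁ × E₂) :=
  {p | ∃ w w', (p.1, w) ∈ coneEpigraph K F ∧ w' ∈ A ∧ p.2 = w - w'}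

lemma convex_shiftedEpigraph {K : Set E₂} {F : E₁ → WithTop E₂} (hF : ConeConvex K F)
    {A : Set E₂} (hA : Convex ℝ A) : Convex ℝ (shiftedEpigraph K F A) := by
  rintro ⟨x, q⟩ ⟨w, w', hw, hw', hq⟩ ⟨x₂, q₂⟩ ⟨w₂, w₂', hw₂, hw₂', hq₂⟩ a b ha hb hab
  refine ⟨a • w + b • w₂, a • w' + b • w₂', hF hw hw₂ ha hb hab, hA hw' hw₂' ha hb hab, ?_⟩
  simp only at hq hq₂
  simp only [Prod.smul_mk, Prod.mk_add_mk, hq, hq₂]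
  module

/-- Turns the condition on `F x₀` into one on the epigraph. To move away from `(x, w - w')`, go
backwards in `dom F` to a point with value `d`, then correct the vertical error by prolonging in `A
- K`. With `A = {0}` it also covers the constraint `G x ∈ -L`. -/
theorem isRelCore_shiftedEpigraph {K : ProperCone ℝ E₂} {F : E₁ → WithTop E₂}
    (hF : ConeConvex (K : Set E₂) F) {A : Set E₂} (hA : Convex ℝ A) {x₀ : E₁} {a : E₂}
    (hx₀ : IsRelCore (vecDom F) x₀) (ha : F x₀ = (a : WithTop E₂))
    (haA : IsRelCore (A - (K : Set E₂)) a) :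
    IsRelCore (shiftedEpigraph (K : Set E₂) F A) (x₀, 0) := by
  have hB : Convex ℝ (A - (K : Set E₂)) := hA.sub (convex_properCone K)
  constructor
  · obtain ⟨w', hw', k, hk, hwk⟩ := Set.mem_sub.1 haA.1
    refine ⟨a + k, w', add_mem_coneEpigraph (mem_coneEpigraph_of_eq ha) hk, hw', ?_⟩
    simp [← hwk]
  rintro ⟨x, q⟩ ⟨w, w', hw, hw', hq⟩
  simp only at hw hq
  subst hq
  have hxdom : x ∈ vecDom F := by
    obtain ⟨c, hc, -⟩ := hw
    simp only at hc
    simp [vecDom, hc]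
  obtain ⟨δ, hδ, hd⟩ := hx₀.2 x hxdom
  obtain ⟨d, hd⟩ := WithTop.ne_top_iff_exists.1 hd
  have hdm : (x₀ - δ • (x - x₀), d) ∈ coneEpigraph (K : Set E₂) F :=
    mem_coneEpigraph_of_eq hd.symm
  -- The weights bring the first coordinate back to `x₀`, so the gap `k` in the convexity inequality
  -- lies in `K`.
  have hm := hF hdm hw (a := 1 / (1 + δ)) (b := δ / (1 + δ)) (by positivity) (by positivity)
    (by field_simp)
  have hfst : (1 / (1 + δ)) • (x₀ - δ • (x - x₀)) + (δ / (1 + δ)) • x = x₀ := by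
    match_scalars <;> (field_simp; ring)
  simp only [Prod.smul_mk, Prod.mk_add_mk, hfst] at hm
  obtain ⟨a', ha', hk⟩ := hm
  simp only at ha' hk
  obtain rfl : a = a' := WithTop.coe_injective (ha.symm.trans ha')
  set k := (1 / (1 + δ)) • d + (δ / (1 + δ)) • w - a with hkdef
  have hw'B : w' ∈ A - (K : Set E₂) := Set.mem_sub.2 ⟨w', hw', 0, K.zero_mem, sub_zero _⟩
  have hakB : a - k ∈ A - (K : Set E₂) := by
    obtain ⟨v, hv, k', hk', h⟩ := Set.mem_sub.1 haA.1
    exact Set.mem_sub.2 ⟨v, hv, k' + k, K.add_mem hk' hk, by rw [← h]; abel⟩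
  -- The weights are chosen so that `a - b` is proportional to the vertical error, as in `hkey`.
  have hbB := hB hw'B hakB (a := δ / (1 + 2 * δ)) (b := (1 + δ) / (1 + 2 * δ)) (by positivity)
    (by positivity) (by field_simp; ring)
  set b := (δ / (1 + 2 * δ)) • w' + ((1 + δ) / (1 + 2 * δ)) • (a - k) with hbdef
  have hkey : (1 + 2 * δ) • (a - b) = d - a + δ • (w - w') := by
    rw [hbdef, hkdef]
    match_scalars <;> field_simp
    ring
  obtain ⟨η, hη, hη'⟩ := haA.2 b hbB
  -- `θ ≤ 1` allows a convex combination of `d` and `a`; the other bound keeps the prolongation past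
  -- `a` within `η`.
  set θ := min 1 (η / (1 + 2 * δ)) with hθdef
  have hθ : 0 < θ := lt_min one_pos (by positivity)
  have hθη : θ * (1 + 2 * δ) ≤ η := (le_div_iff₀ (by positivity)).1 (min_le_right _ _)
  obtain ⟨v, hv, k', hk', hvk⟩ := Set.mem_sub.1
    (prolongation_mem_of_le hB haA.1 hη hη' (by positivity) hθη)
  refine ⟨θ * δ, by positivity, θ • d + (1 - θ) • a + k', v, ?_, hv, ?_⟩
  · have h := hF hdm (mem_coneEpigraph_of_eq (K := K) ha) hθ.le
      (sub_nonneg.2 (min_le_left 1 (η / (1 + 2 * δ)))) (by rw [← hθdef]; ring)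
    rw [← hθdef] at h
    have h2 := add_mem_coneEpigraph h hk'
    have hpt : ((x₀, (0 : E₂)) - (θ * δ) • ((x, w - w') - (x₀, (0 : E₂)))).1
        = θ • (x₀ - δ • (x - x₀)) + (1 - θ) • x₀ := by
      simp only [Prod.fst_sub, Prod.smul_fst]
      module
    rw [hpt]
    exact h2
  · have hv' : v = a + θ • ((1 + 2 * δ) • (a - b)) + k' := by
      rw [← sub_eq_iff_eq_add, hvk]
      module
    rw [hv', hkey]
    simp only [Prod.snd_sub, Prod.smul_snd]
    module

end ConeEpigraph

end ConvexComposite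

namespace ConvexComposite

/-! ### Bounds for conjugates and weak duality -/

section Conjugates

variable {E E₁ E₂ : Type*}
  [NormedAddCommGroup E] [InnerProductSpace ℝ E]
  [NormedAddCommGroup E₁] [InnerProductSpace ℝ E₁]
  [NormedAddCommGroup E₂] [InnerProductSpace ℝ E₂]

lemma compTop_of_eq_coe {S T : Type*} (g : T → EReal) {F : S → WithTop T} {x : S} {w : T}
    (h : F x = (w : WithTop T)) : compTop g F x = g w := by
  simp [compTop, h]

lemma compTop_of_eq_top {S T : Type*} (g : T → EReal) {F : S → WithTop T} {x : S}
    (h : F x = ⊤) :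
    compTop g F x = ⊤ := by
  simp [compTop, h]

lemma effDom_eq_image_epigraph {T : Type*} (h : T → EReal) : effDom h = Prod.fst '' epigraph h := by
  ext x
  constructor
  · intro hx
    obtain ⟨r, hr, -⟩ := EReal.lt_iff_exists_real_btwn.1 (show h x < ⊤ from hx)
    exact ⟨(x, r), hr.le, rfl⟩
  · rintro ⟨⟨x, r⟩, hr, rfl⟩
    exact lt_of_le_of_lt hr (EReal.coe_lt_top r)

lemma IsGamma.convex_effDom {h : E → EReal} (hh : IsGamma h) : Convex ℝ (effDom h) := by
  rw [effDom_eq_image_epigraph]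
  exact hh.convex_epigraph.linear_image (LinearMap.fst ℝ E ℝ)

lemma IsGamma.conj_le {h : E → EReal} (hh : IsGamma h) {u : E} {c : ℝ}
    (hc : ∀ p ∈ epigraph h, inner ℝ u p.1 - p.2 ≤ c) : conj h u ≤ c := by
  refine iSup_le fun x => ?_
  induction hx : h x with
  | bot => exact absurd hx (hh.ne_bot x)
  | top => simp
  | coe r => exact_mod_cast hc (x, r) hx.le

lemma conj_scalarization_le {K : ProperCone ℝ E₂} {F : E₁ → WithTop E₂} {u : E₂} {y : E₁} {c : ℝ}
    (hc : ∀ p ∈ coneEpigraph (K : Set E₂) F, inner ℝ y p.1 - inner ℝ u p.2 ≤ c) :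
    conj (scalarization u F) y ≤ c := by
  refine iSup_le fun x => ?_
  induction hx : F x with
  | top => simp [scalarization, compTop_of_eq_top _ hx]
  | coe w =>
    rw [scalarization, compTop_of_eq_coe _ hx]
    exact_mod_cast hc (x, w) (mem_coneEpigraph_of_eq hx)

lemma supportFun_le {X : Set E} {s : E} {c : ℝ} (hc : ∀ x ∈ X, inner ℝ s x ≤ c) :
    supportFun X s ≤ c :=
  iSup₂_le fun x hx => by exact_mod_cast hc x hx

lemma le_conj {h : E → EReal} {x : E} {r : ℝ} (hx : h x = r) (y : E) :
    ((inner ℝ y x - r : ℝ) : EReal) ≤ conj h y := by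
  rw [EReal.coe_sub, ← hx]
  exact le_iSup (fun x => ((inner ℝ y x : ℝ) : EReal) - h x) x

lemma le_supportFun {X : Set E} {x : E} (hx : x ∈ X) (s : E) :
    ((inner ℝ s x : ℝ) : EReal) ≤ supportFun X s :=
  le_iSup₂ (f := fun x (_ : x ∈ X) => ((inner ℝ s x : ℝ) : EReal)) x hx

/-- A vector whose inner product is bounded below on a cone is in the dual cone. -/
lemma mem_neg_polarCone_of_le {K : ProperCone ℝ E} {u : E} {c : ℝ}
    (h : ∀ k ∈ K, c ≤ inner ℝ u k) : u ∈ -polarCone (K : Set E) := by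
  rw [Set.mem_neg]
  intro k hk
  rw [inner_neg_left, neg_nonpos]
  by_contra! hneg
  have hpos : 0 < -inner ℝ u k := by linarith
  -- The scaling makes the inner product `-(|c| + 1)`, which is below `c`.
  have := h (((|c| + 1) / (-inner ℝ u k)) • k) (K.smul_mem hk (by positivity))
  rw [inner_smul_right, div_mul_eq_mul_div, div_neg, mul_div_assoc, div_self hneg.ne] at this
  linarith [neg_abs_le c]

/-- Weak duality. -/
theorem add_compTop_nonneg_of_dual {X : Set E₁} {L : Set E₂} {F G : E₁ → WithTop E₂}
    {f : E₁ → EReal} (hf : ∀ x, f x ≠ ⊥) {g : E₂ → EReal} (hg : ∀ w, g w ≠ ⊥)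
    {y z s : E₁} {u v : E₂} (hv : v ∈ -polarCone L)
    (h : conj g u + conj (scalarization u F) y + conj (scalarization v G) z + supportFun X s
      + conj f (-y - z - s) ≤ 0)
    {x : E₁} (hx : x ∈ X) {b : E₂} (hb : b ∈ -L) (hGx : G x = (b : WithTop E₂)) :
    0 ≤ f x + compTop g F x := by
  induction hFx : F x with
  | top => rw [compTop_of_eq_top _ hFx, EReal.add_top_of_ne_bot (hf x)]; exact le_top
  | coe w =>
  rw [compTop_of_eq_coe _ hFx]
  induction hgw : g w with
  | bot => exact absurd hgw (hg w)
  | top => rw [EReal.add_top_of_ne_bot (hf x)]; exact le_top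
  | coe r =>
  induction hfx : f x with
  | bot => exact absurd hfx (hf x)
  | top => rw [EReal.top_add_coe]; exact le_top
  | coe t =>
  have hsF : scalarization u F x = ((inner ℝ u w : ℝ) : EReal) := compTop_of_eq_coe _ hFx
  have hsG : scalarization v G x = ((inner ℝ v b : ℝ) : EReal) := compTop_of_eq_coe _ hGx
  have hsum := (add_le_add (add_le_add (add_le_add (add_le_add (le_conj hgw u) (le_conj hsF y))
    (le_conj hsG z)) (le_supportFun hx s)) (le_conj hfx (-y - z - s))).trans h
  have hsum' : inner ℝ u w - r + (inner ℝ y x - inner ℝ u w) + (inner ℝ z x - inner ℝ v b)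
      + inner ℝ s x + (inner ℝ (-y - z - s) x - t) ≤ 0 := by exact_mod_cast hsum
  have hvb : inner ℝ v b ≤ 0 := by
    have := Set.mem_neg.1 hv (-b) hb
    rwa [inner_neg_neg] at this
  rw [inner_sub_left, inner_sub_left, inner_neg_left] at hsum'
  have : 0 ≤ t + r := by linarith
  exact_mod_cast this

end Conjugates

/-! ### Splitting a bound on sums into separate bounds -/

lemma exists_real_between {A : Set ℝ} {B : Set ℝ} (hA : A.Nonempty) (hB : B.Nonempty)
    (h : ∀ a ∈ A, ∀ b ∈ B, a + b ≤ 0) : ∃ c, (∀ a ∈ A, a ≤ c) ∧ ∀ b ∈ B, c + b ≤ 0 := by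
  obtain ⟨b₀, hb₀⟩ := hB
  have hbdd : BddAbove A := ⟨-b₀, fun a ha => by linarith [h a ha b₀ hb₀]⟩
  refine ⟨sSup A, fun a ha => le_csSup hbdd ha, fun b hb => ?_⟩
  have := csSup_le hA (a := -b) fun a ha => by linarith [h a ha b hb]
  linarith

/-- If all sums of elements of five nonempty sets are nonpositive, so is the sum of suitable upper
bounds of these sets. -/
lemma exists_upper_bounds_add_nonpos {A B C D P : Set ℝ} (hA : A.Nonempty) (hB : B.Nonempty)
    (hC : C.Nonempty) (hD : D.Nonempty) (hP : P.Nonempty)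
    (h : ∀ a ∈ A, ∀ b ∈ B, ∀ c ∈ C, ∀ d ∈ D, ∀ p ∈ P, a + b + c + d + p ≤ 0) :
    ∃ α β γ δ π : ℝ, α + β + γ + δ + π ≤ 0 ∧ (∀ a ∈ A, a ≤ α) ∧ (∀ b ∈ B, b ≤ β) ∧
      (∀ c ∈ C, c ≤ γ) ∧ (∀ d ∈ D, d ≤ δ) ∧ ∀ p ∈ P, p ≤ π := by
  obtain ⟨α, hα, h₁⟩ := exists_real_between hA (hB.add (hC.add (hD.add hP))) (by
    rintro a ha _ ⟨b, hb, _, ⟨c, hc, _, ⟨d, hd, p, hp, rfl⟩, rfl⟩, rfl⟩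
    simpa only [add_assoc] using h a ha b hb c hc d hd p hp)
  obtain ⟨β, hβ, h₂⟩ := exists_real_between hB ((Set.singleton_nonempty α).add (hC.add (hD.add hP)))
    (by
      rintro b hb _ ⟨_, rfl, q, hq, rfl⟩
      have := h₁ (b + q) ⟨b, hb, q, hq, rfl⟩
      simp only
      linarith)
  obtain ⟨γ, hγ, h₃⟩ := exists_real_between hC ((Set.singleton_nonempty (α + β)).add (hD.add hP))
    (by
      rintro c hc _ ⟨_, rfl, q, hq, rfl⟩
      have := h₂ (α + (c + q)) ⟨α, rfl, c + q, ⟨c, hc, q, hq, rfl⟩, rfl⟩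
      simp only
      linarith)
  obtain ⟨δ, hδ, h₄⟩ := exists_real_between hD ((Set.singleton_nonempty (α + β + γ)).add hP)
    (by
      rintro d hd _ ⟨_, rfl, p, hp, rfl⟩
      have := h₃ (α + β + (d + p)) ⟨α + β, rfl, d + p, ⟨d, hd, p, hp, rfl⟩, rfl⟩
      simp only
      linarith)
  refine ⟨α, β, γ, δ, -(α + β + γ + δ), by linarith, hα, hβ, hγ, hδ, fun p hp => ?_⟩
  have := h₄ (α + β + γ + p) ⟨α + β + γ, rfl, p, hp, rfl⟩
  linarith

/-! ### Perturbations and existence of multipliers -/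

section Duality

variable {E₁ E₂ : Type*}
  [NormedAddCommGroup E₁] [InnerProductSpace ℝ E₁]
  [NormedAddCommGroup E₂] [InnerProductSpace ℝ E₂]

/-- The perturbation `(x₁ - x₀, x₂ - x₀, x₃ - x₀, q₁, q₂)`. -/
def perturbation : E₁ × E₁ × (E₁ × E₂) × (E₁ × E₂) →ₗ[ℝ] E₁ × E₁ × E₁ × E₂ × E₂ where
  toFun p := (p.2.1 - p.1, p.2.2.1.1 - p.1, p.2.2.2.1 - p.1, p.2.2.1.2, p.2.2.2.2)
  map_add' p q := by
    simp only [Prod.fst_add, Prod.snd_add, Prod.mk_add_mk, add_sub_add_comm]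
  map_smul' r p := by
    simp only [Prod.smul_fst, Prod.smul_snd, Prod.smul_mk, smul_sub, RingHom.id_apply]

/-- The perturbation together with the value `r₀ + r` of the objective. -/
def perturbationValue :
    (E₁ × ℝ) × E₁ × (E₁ × E₂) × (E₁ × E₂) × (E₂ × ℝ) →ₗ[ℝ] (E₁ × E₁ × E₁ × E₂ × E₂) × ℝ where
  toFun p := (perturbation (p.1.1, p.2.1, (p.2.2.1.1, p.2.2.1.2 - p.2.2.2.2.1), p.2.2.2.1),
    p.1.2 + p.2.2.2.2.2)
  map_add' p q := by
    simp only [Prod.fst_add, Prod.snd_add, ← map_add, Prod.mk_add_mk, add_sub_add_comm,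
      add_add_add_comm]
  map_smul' r p := by
    simp only [Prod.smul_fst, Prod.smul_snd, ← map_smul, Prod.smul_mk, smul_sub, smul_add,
      RingHom.id_apply]

/-- Forgetting the objective value leaves only the effective domains, the form in which the
qualification condition applies. -/
lemma fst_image_perturbationValue (X : Set E₁) (K L : ProperCone ℝ E₂) (F G : E₁ → WithTop E₂)
    (f : E₁ → EReal) (g : E₂ → EReal) :
    Prod.fst '' (perturbationValue '' (epigraph f ×ˢ X ×ˢ coneEpigraph (K : Set E₂) F ×ˢ
      coneEpigraph (L : Set E₂) G ×ˢ epigraph g)) = perturbation '' (effDom f ×ˢ X ×ˢ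
      shiftedEpigraph (K : Set E₂) F (effDom g) ×ˢ shiftedEpigraph (L : Set E₂) G {0}) := by

  rw [effDom_eq_image_epigraph f, effDom_eq_image_epigraph g]
  ext m
  constructor
  · rintro ⟨_, ⟨⟨p₀, x₁, p, q, w⟩, ⟨h₀, h₁, h₂, h₃, h₄⟩, rfl⟩, rfl⟩
    exact ⟨(p₀.1, x₁, (p.1, p.2 - w.1), q), ⟨⟨p₀, h₀, rfl⟩, h₁,
      ⟨p.2, w.1, h₂, ⟨w, h₄, rfl⟩, rfl⟩, ⟨q.2, 0, h₃, rfl, (sub_zero _).symm⟩⟩, rfl⟩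
  · rintro ⟨⟨x₀, x₁, ⟨x₂, q₁⟩, ⟨x₃, q₂⟩⟩, ⟨⟨p₀, h₀, rfl⟩, h₁, ⟨w₁, w, h₂, ⟨w', h₄, hw'⟩, hq₁⟩,
      ⟨w₂, o, h₃, ho, hq₂⟩⟩, rfl⟩
    simp only at h₁ h₂ h₃ hq₁ hq₂
    obtain rfl : o = 0 := ho
    rw [sub_zero] at hq₂
    subst hq₁ hq₂ hw'
    exact ⟨_, ⟨(p₀, x₁, (x₂, w₁), (x₃, q₂), w'), ⟨h₀, h₁, h₂, h₃, h₄⟩, rfl⟩, rfl⟩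

lemma isRelCore_image_perturbation {X : Set E₁} (hX : Convex ℝ X) {K L : ProperCone ℝ E₂}
    {F G : E₁ → WithTop E₂} (hF : ConeConvex (K : Set E₂) F) (hG : ConeConvex (L : Set E₂) G)
    {f : E₁ → EReal} (hf : IsGamma f) {g : E₂ → EReal} (hg : IsGamma g)
    (hCQ : FarkasCQ X (K : Set E₂) (L : Set E₂) f g F G) :
    IsRelCore (perturbation '' (effDom f ×ˢ X ×ˢ shiftedEpigraph (K : Set E₂) F (effDom g) ×ˢ
      shiftedEpigraph (L : Set E₂) G {0})) 0 := by
  obtain ⟨x, ⟨⟨⟨hxX, hxf⟩, hxF⟩, hxG⟩, ⟨a, haA, ha⟩, b, hbL, hb⟩ := hCQ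
  have hL : ({0} : Set E₂) - (L : Set E₂) = -(L : Set E₂) := by
    rw [Set.singleton_zero, zero_sub]
  have hcF := isRelCore_shiftedEpigraph hF hg.convex_effDom
    (isRelCore_of_mem_intrinsicInterior hxF) ha (isRelCore_of_mem_intrinsicInterior haA)
  rw [← hL] at hbL
  have hcG := isRelCore_shiftedEpigraph hG (convex_singleton (0 : E₂))
    (isRelCore_of_mem_intrinsicInterior hxG) hb (isRelCore_of_mem_intrinsicInterior hbL)
  have hHF := convex_shiftedEpigraph hF hg.convex_effDom
  have hHG := convex_shiftedEpigraph hG (convex_singleton (0 : E₂))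
  have hH := hHF.prod hHG
  have hcX := IsRelCore.prod hX hH (isRelCore_of_mem_intrinsicInterior hxX)
    (IsRelCore.prod hHF hHG hcF hcG)
  have hXH := hX.prod hH
  have hcore := IsRelCore.prod hf.convex_effDom hXH (isRelCore_of_mem_intrinsicInterior hxf) hcX
  have hzero : perturbation (x, x, (x, (0 : E₂)), (x, (0 : E₂))) = 0 := by
    simp [perturbation]
  exact hzero ▸ hcore.image perturbation

lemma exists_inner_representative {E : Type*} [NormedAddCommGroup E] [InnerProductSpace ℝ E]
    [FiniteDimensional ℝ E] (l : E →ₗ[ℝ] ℝ) : ∃ v : E, ∀ x, l x = inner ℝ v x := by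
  have : CompleteSpace E := FiniteDimensional.complete ℝ E
  exact ⟨(InnerProductSpace.toDual ℝ E).symm (LinearMap.toContinuousLinearMap l),
    fun x => by simp⟩

variable [FiniteDimensional ℝ E₁] [FiniteDimensional ℝ E₂]

lemma exists_inner_representatives (l : E₁ × E₁ × E₁ × E₂ × E₂ →ₗ[ℝ] ℝ) :
    ∃ (s y z : E₁) (u v : E₂), ∀ a b c p q, l (a, b, c, p, q) =
      inner ℝ s a + inner ℝ y b + inner ℝ z c - inner ℝ u p - inner ℝ v q := by
  obtain ⟨s, hs⟩ := exists_inner_representative (l ∘ₗ LinearMap.inl ℝ _ _)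
  obtain ⟨y, hy⟩ := exists_inner_representative (l ∘ₗ LinearMap.inr ℝ _ _ ∘ₗ LinearMap.inl ℝ _ _)
  obtain ⟨z, hz⟩ := exists_inner_representative
    (l ∘ₗ LinearMap.inr ℝ _ _ ∘ₗ LinearMap.inr ℝ _ _ ∘ₗ LinearMap.inl ℝ _ _)
  obtain ⟨u, hu⟩ := exists_inner_representative
    (l ∘ₗ LinearMap.inr ℝ _ _ ∘ₗ LinearMap.inr ℝ _ _ ∘ₗ LinearMap.inr ℝ _ _ ∘ₗ
      LinearMap.inl ℝ _ _)
  obtain ⟨v, hv⟩ := exists_inner_representative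
    (l ∘ₗ LinearMap.inr ℝ _ _ ∘ₗ LinearMap.inr ℝ _ _ ∘ₗ LinearMap.inr ℝ _ _ ∘ₗ
      LinearMap.inr ℝ _ _)
  -- The signs are those that will place the multipliers in `-K°` and `-L°`.
  refine ⟨s, y, z, -u, -v, fun a b c p q => ?_⟩
  rw [← hs, ← hy, ← hz, inner_neg_left, inner_neg_left, ← hu, ← hv, sub_neg_eq_add, sub_neg_eq_add]
  simp only [LinearMap.comp_apply, LinearMap.inl_apply, LinearMap.inr_apply, ← map_add]
  simp

/-- Existence of multipliers under the relative interior condition. -/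
theorem exists_multipliers {X : Set E₁} (hX : Convex ℝ X) {K L : ProperCone ℝ E₂}
    {F G : E₁ → WithTop E₂} (hF : ConeConvex (K : Set E₂) F) (hG : ConeConvex (L : Set E₂) G)
    {f : E₁ → EReal} (hf : IsGamma f) {g : E₂ → EReal} (hg : IsGamma g)
    (hgF : MonotoneAlong (K : Set E₂) F g)
    (hCQ : FarkasCQ X (K : Set E₂) (L : Set E₂) f g F G)
    (hpos : ∀ x ∈ X, (∃ b ∈ -(L : Set E₂), G x = (b : WithTop E₂)) → 0 ≤ f x + compTop g F x) :
    ∃ (s y z : E₁) (u v : E₂), ∀ p₀ ∈ epigraph f, ∀ x₁ ∈ X,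
      ∀ p ∈ coneEpigraph (K : Set E₂) F, ∀ q ∈ coneEpigraph (L : Set E₂) G, ∀ w ∈ epigraph g,
        inner ℝ s (x₁ - p₀.1) + inner ℝ y (p.1 - p₀.1) + inner ℝ z (q.1 - p₀.1)
          - inner ℝ u (p.2 - w.1) - inner ℝ v q.2 ≤ p₀.2 + w.2 := by
  have hcore := isRelCore_image_perturbation hX hF hG hf hg hCQ
  set S := perturbationValue '' (epigraph f ×ˢ X ×ˢ coneEpigraph (K : Set E₂) F ×ˢ
    coneEpigraph (L : Set E₂) G ×ˢ epigraph g) with hS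
  have hSconv : Convex ℝ S :=
    (hf.convex_epigraph.prod (hX.prod (hF.prod (hG.prod hg.convex_epigraph)))).linear_image _
  have hproj := fst_image_perturbationValue X K L F G f g
  obtain ⟨l, hl⟩ := exists_linear_minorant hSconv (by rwa [hproj]) (by
    rintro t ⟨⟨⟨x₀, r₀⟩, x₁, ⟨x₂, w₁⟩, ⟨x₃, w₂⟩, ⟨w, r⟩⟩, ⟨h₀, h₁, h₂, h₃, h₄⟩, ht⟩
    simp only [perturbationValue, perturbation, LinearMap.coe_mk, AddHom.coe_mk, Prod.mk.injEq,
      Prod.mk_eq_zero, sub_eq_zero] at ht h₁ h₂ h₃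
    -- At zero perturbation all copies of `x` agree, `w₁ = w`, and `w₂ = 0`, which means `G x ∈ -L`.
    obtain ⟨⟨rfl, rfl, rfl, rfl, rfl⟩, rfl⟩ := ht
    obtain ⟨b', hb', hbL'⟩ := h₃
    have h := hpos _ h₁ ⟨b', by simpa using hbL', hb'⟩
    have h' := h.trans (add_le_add h₀ ((hgF _ h₂).trans h₄))
    exact_mod_cast h')
  obtain ⟨s, y, z, u, v, hrep⟩ := exists_inner_representatives l
  refine ⟨s, y, z, u, v, fun p₀ h₀ x₁ h₁ p h₂ q h₃ w h₄ => ?_⟩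
  rw [← hrep]
  exact hl _ ⟨(p₀, x₁, p, q, w), ⟨h₀, h₁, h₂, h₃, h₄⟩, rfl⟩

end Duality

end ConvexComposite

/-! ### The Farkas-type equivalence -/

theorem mainTheorem11 {E₁ E₂ : Type*}
    [NormedAddCommGroup E₁] [InnerProductSpace ℝ E₁] [FiniteDimensional ℝ E₁]
    [NormedAddCommGroup E₂] [InnerProductSpace ℝ E₂] [FiniteDimensional ℝ E₂]
    (X : Set E₁) (hXne : X.Nonempty) (hX : Convex ℝ X)
    (K L : ProperCone ℝ E₂)
    (F G : E₁ → WithTop E₂)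
    (hF : ConvexComposite.ConeConvex (K : Set E₂) F)
    (hG : ConvexComposite.ConeConvex (L : Set E₂) G)
    (f : E₁ → EReal) (hf : ConvexComposite.IsGamma f)
    (g : E₂ → EReal) (hg : ConvexComposite.IsGamma g)
    (hgF : ConvexComposite.MonotoneAlong (K : Set E₂) F g)
    (hCQ : ConvexComposite.FarkasCQ X (K : Set E₂) (L : Set E₂) f g F G) :
    (∀ x ∈ X, (∃ b ∈ -(L : Set E₂), G x = (b : WithTop E₂)) →
        0 ≤ f x + ConvexComposite.compTop g F x) ↔
      ∃ y z s : E₁, ∃ u ∈ -(ConvexComposite.polarCone (K : Set E₂)),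
        ∃ v ∈ -(ConvexComposite.polarCone (L : Set E₂)),
          ConvexComposite.conj g u
            + ConvexComposite.conj (ConvexComposite.scalarization u F) y
            + ConvexComposite.conj (ConvexComposite.scalarization v G) z
            + ConvexComposite.supportFun X s
            + ConvexComposite.conj f (-y - z - s) ≤ 0 := by
  open ConvexComposite in
  constructor
  · intro hpos
    obtain ⟨s, y, z, u, v, h⟩ := exists_multipliers hX hF hG hf hg hgF hCQ hpos
    obtain ⟨x, -, ⟨a, -, ha⟩, b, -, hb⟩ := hCQ
    have hfne : (epigraph f).Nonempty := by
      have := hf.nonempty_dom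
      rwa [effDom_eq_image_epigraph, Set.image_nonempty] at this
    have hgne : (epigraph g).Nonempty := by
      have := hg.nonempty_dom
      rwa [effDom_eq_image_epigraph, Set.image_nonempty] at this
    have hFa : (x, a) ∈ coneEpigraph (K : Set E₂) F := mem_coneEpigraph_of_eq ha
    have hGb : (x, b) ∈ coneEpigraph (L : Set E₂) G := mem_coneEpigraph_of_eq hb
    obtain ⟨cg, cF, cG, cX, cf, hsum, hcg, hcF, hcG, hcX, hcf⟩ := exists_upper_bounds_add_nonpos
      (hgne.image fun w => inner ℝ u w.1 - w.2)
      (Set.Nonempty.image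
        (fun p => inner ℝ y p.1 - inner ℝ u p.2) ⟨_, hFa⟩)
      (Set.Nonempty.image
        (fun p => inner ℝ z p.1 - inner ℝ v p.2) ⟨_, hGb⟩)
      (hXne.image fun x₁ => inner ℝ s x₁)
      (hfne.image fun p => inner ℝ (-y - z - s) p.1 - p.2) (by
        rintro _ ⟨w, hw, rfl⟩ _ ⟨p, hp, rfl⟩ _ ⟨q, hq, rfl⟩ _ ⟨x₁, hx₁, rfl⟩ _ ⟨p₀, hp₀, rfl⟩
        have := h p₀ hp₀ x₁ hx₁ p hp q hq w hw
        simp only [inner_sub_left, inner_sub_right, inner_neg_left] at this ⊢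
        linarith)
    simp only [Set.forall_mem_image] at hcg hcF hcG hcX hcf
    refine ⟨y, z, s, u, ?_, v, ?_, ?_⟩
    -- The epigraph absorbs translations by `K`, so the upper bound `cF` bounds `⟨u, k⟩` below on
    -- `K`.
    · refine mem_neg_polarCone_of_le (c := inner ℝ y x - inner ℝ u a - cF) fun k hk => ?_
      have := hcF (add_mem_coneEpigraph hFa hk)
      rw [inner_add_right] at this
      linarith
    · refine mem_neg_polarCone_of_le (c := inner ℝ z x - inner ℝ v b - cG) fun k hk => ?_
      have := hcG (add_mem_coneEpigraph hGb hk)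
      rw [inner_add_right] at this
      linarith
    · refine (add_le_add (add_le_add (add_le_add (add_le_add (hg.conj_le fun _ h => hcg h)
        (conj_scalarization_le fun _ h => hcF h)) (conj_scalarization_le fun _ h => hcG h))
        (supportFun_le fun _ h => hcX h)) (hf.conj_le fun _ h => hcf h)).trans ?_
      exact_mod_cast hsum
  · rintro ⟨y, z, s, u, -, v, hv, h⟩ x hx ⟨b, hb, hGx⟩
    exact add_compTop_nonneg_of_dual hf.ne_bot hg.ne_bot hv h hx hb hGx
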